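/- An $\mathsf{L}_2$-structure $M$ consists of a set of numbers with interpretations of $0,1,+,\cdot,<$ and a collection of subsets of it, the sets of $M$; it is a model of $\mathsf{RCA}_0$ if it satisfies the axioms of a discrete ordered semiring, the $\Sigma^0_1$ induction scheme and the $\Delta^0_1$ comprehension scheme (with number and set parameters from $M$). Consider the following two principles, all notions being understood inside $M$. ($\Pi^0_1\mathsf{G}$) For any uniformly $\Pi^0_1$ collection of sets $D_i$ (that is, $\sigma\in D_i\leftrightarrow\varphi(i,\sigma)$ for one $\Pi^0_1$ formula $\varphi$ with parameters), each of which is dense in $2^{<\mathbb{N}}$ (every $\sigma\in 2^{<\mathbb N}$ has an extension in $D_i$), there is a set $G$ such that for every $i$ there is an $s$ with $G\upharpoonright s\in D_i$. ($\mathsf{FIP}$) A family of sets is a sequence $A=\langle A_i:i\in\mathbb{N}\rangle$ of sets; it is nontrivial if some $A_i$ is nonempty, and $X\in A$ means that $X=A_i$ for some $i$. A family $B=\langle B_i : i\in\mathbb N\rangle$ is a subfamily of $A$ if every $B_i$ is in $A$. A subfamily $B$ of $A$ has the $F$ intersection property if the intersection of any $m\ge 2$ distinct sets in $B$ is nonempty,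 i.e. for every finite set $F$ of numbers with at least two elements such that $A_i\in B$ for all $i\in F$ and $A_i\neq A_j$ for all distinct $i,j\in F$, we have $\bigcap_{i\in F}A_i\neq\emptyset$. The subfamily $B$ is a maximal subfamily of $A$ with this property if $B$ has it and every subfamily $C$ of $A$ that also has it, and of which $B$ is a subfamily, is a subfamily of $B$. The principle $\mathsf{FIP}$ says that every nontrivial family of sets has a maximal subfamily with the $F$ intersection property. Then $\Pi^0_1\mathsf{G}$ implies $\mathsf{FIP}$ over $\mathsf{RCA}_0$: every model of $\mathsf{RCA}_0$ in which $\Pi^0_1\mathsf{G}$ holds satisfies $\mathsf{FIP}$. -/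

import Mathlib

universe u

/-- A structure for the language of second-order arithmetic: a type of numbers with
interpretations of `0, 1, +, *, <`, and a collection of subsets of it. Equality is
interpreted as equality and membership as membership. -/
structure L2Structure where
  /-- the numbers -/
  Num : Type u
  [zero : Zero Num]
  [one : One Num]
  [add : Add Num]
  [mul : Mul Num]
  [lt : LT Num]
  /-- the sets -/
  Sets : Set (Set Num)

namespace L2Structure

attribute [instance] L2Structure.zero L2Structure.one L2Structure.add L2Structure.mul
  L2Structure.lt

end L2Structure

/-- Number terms of second-order arithmetic with free variables among `0, …, n - 1`. -/
inductive NumTerm : ℕ → Type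
  | var {n : ℕ} (i : Fin n) : NumTerm n
  | zero {n : ℕ} : NumTerm n
  | one {n : ℕ} : NumTerm n
  | add {n : ℕ} (s t : NumTerm n) : NumTerm n
  | mul {n : ℕ} (s t : NumTerm n) : NumTerm n

/-- The `Σ⁰₀` formulas of second-order arithmetic (all quantifiers are bounded number
quantifiers) with `n` free number variables and `k` free set variables. A quantifier binds
the number variable `0` of its body and does not bind the variables of its bounding term. -/
inductive SigmaZeroFormula (k : ℕ) : ℕ → Type
  | eq {n : ℕ} (s t : NumTerm n) : SigmaZeroFormula k n
  | lt {n : ℕ} (s t : NumTerm n) : SigmaZeroFormula k n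
  | mem {n : ℕ} (t : NumTerm n) (X : Fin k) : SigmaZeroFormula k n
  | not {n : ℕ} (φ : SigmaZeroFormula k n) : SigmaZeroFormula k n
  | and {n : ℕ} (φ ψ : SigmaZeroFormula k n) : SigmaZeroFormula k n
  | or {n : ℕ} (φ ψ : SigmaZeroFormula k n) : SigmaZeroFormula k n
  | ball {n : ℕ} (t : NumTerm n) (φ : SigmaZeroFormula k (n + 1)) : SigmaZeroFormula k n
  | bex {n : ℕ} (t : NumTerm n) (φ : SigmaZeroFormula k (n + 1)) : SigmaZeroFormula k n

/-- The value of a number term in a structure. -/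
def NumTerm.eval (M : L2Structure.{u}) : {n : ℕ} → NumTerm n → (Fin n → M.Num) → M.Num
  | _, .var i, v => v i
  | _, .zero, _ => 0
  | _, .one, _ => 1
  | _, .add s t, v => s.eval M v + t.eval M v
  | _, .mul s t, v => s.eval M v * t.eval M v

/-- Truth of a `Σ⁰₀` formula in a structure. -/
def SigmaZeroFormula.Holds (M : L2Structure.{u}) {k : ℕ} :
    {n : ℕ} → SigmaZeroFormula k n → (Fin n → M.Num) → (Fin k → Set M.Num) → Prop
  | _, .eq s t, v, _ => s.eval M v = t.eval M v
  | _, .lt s t, v, _ => s.eval M v < t.eval M v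
  | _, .mem t X, v, W => t.eval M v ∈ W X
  | _, .not φ, v, W => ¬ φ.Holds M v W
  | _, .and φ ψ, v, W => φ.Holds M v W ∧ ψ.Holds M v W
  | _, .or φ ψ, v, W => φ.Holds M v W ∨ ψ.Holds M v W
  | _, .ball t φ, v, W => ∀ x : M.Num, x < t.eval M v → φ.Holds M (Fin.cons x v) W
  | _, .bex t φ, v, W => ∃ x : M.Num, x < t.eval M v ∧ φ.Holds M (Fin.cons x v) W

namespace L2Structure

variable (M : L2Structure.{u})

/-! ### Definability with number and set parameters from the structure -/

/-- `R` is defined in `M` by a `Σ⁰₀` formula with number and set parameters from `M`. -/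
def IsSigma00 {m : ℕ} (R : (Fin m → M.Num) → Prop) : Prop :=
  ∃ (k n : ℕ) (θ : SigmaZeroFormula k (m + n)) (v : Fin n → M.Num) (W : Fin k → Set M.Num),
    (∀ i, W i ∈ M.Sets) ∧ ∀ a : Fin m → M.Num, R a ↔ θ.Holds M (Fin.append a v) W

/-- `P x` is equivalent to `∃ y, θ(x, y)` with `θ` a `Σ⁰₀` formula with parameters. -/
def IsSigma01 (P : M.Num → Prop) : Prop :=
  ∃ R : (Fin 2 → M.Num) → Prop, M.IsSigma00 R ∧ ∀ x, P x ↔ ∃ y, R ![x, y]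

/-- `P x` is equivalent to `∀ y, θ(x, y)` with `θ` a `Σ⁰₀` formula with parameters. -/
def IsPi01 (P : M.Num → Prop) : Prop :=
  ∃ R : (Fin 2 → M.Num) → Prop, M.IsSigma00 R ∧ ∀ x, P x ↔ ∀ y, R ![x, y]

/-- The collection of the `D i` is uniformly `Π⁰₁`: `D i x` is equivalent to
`∀ y, θ(i, x, y)` with a single `Σ⁰₀` formula `θ` with parameters. -/
def IsUniformlyPi01 (D : M.Num → M.Num → Prop) : Prop :=
  ∃ R : (Fin 3 → M.Num) → Prop, M.IsSigma00 R ∧ ∀ i x, D i x ↔ ∀ y, R ![i, x, y]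

/-! ### The axioms of `RCA₀` -/

/-- The axioms of a discrete ordered semiring (the nonnegative part of a discretely ordered
commutative ring). -/
structure IsDiscreteOrderedSemiring : Prop where
  add_assoc : ∀ x y z : M.Num, (x + y) + z = x + (y + z)
  add_comm : ∀ x y : M.Num, x + y = y + x
  mul_assoc : ∀ x y z : M.Num, (x * y) * z = x * (y * z)
  mul_comm : ∀ x y : M.Num, x * y = y * x
  mul_add : ∀ x y z : M.Num, x * (y + z) = x * y + x * z
  add_zero : ∀ x : M.Num, x + 0 = x
  mul_zero : ∀ x : M.Num, x * 0 = 0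
  mul_one : ∀ x : M.Num, x * 1 = x
  lt_irrefl : ∀ x : M.Num, ¬ x < x
  lt_trans : ∀ x y z : M.Num, x < y → y < z → x < z
  lt_trichotomy : ∀ x y : M.Num, x < y ∨ x = y ∨ y < x
  add_lt_add : ∀ x y z : M.Num, x < y → x + z < y + z
  mul_lt_mul : ∀ x y z : M.Num, 0 < z → x < y → x * z < y * z
  exists_add_of_lt : ∀ x y : M.Num, x < y → ∃ z, x + z = y
  zero_lt_one : (0 : M.Num) < 1
  eq_zero_or_pos : ∀ x : M.Num, x = 0 ∨ 0 < x
  one_le_of_pos : ∀ x : M.Num, 0 < x → x = 1 ∨ 1 < x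

/-- `M` is a model of `RCA₀`. -/
structure IsRCA0 : Prop where
  semiring : M.IsDiscreteOrderedSemiring
  /-- the `Σ⁰₁` induction scheme -/
  sigma01_induction : ∀ P : M.Num → Prop, M.IsSigma01 P →
    P 0 → (∀ x, P x → P (x + 1)) → ∀ x, P x
  /-- the `Δ⁰₁` comprehension scheme -/
  delta01_comprehension : ∀ P Q : M.Num → Prop, M.IsSigma01 P → M.IsPi01 Q →
    (∀ x, P x ↔ Q x) → {x | P x} ∈ M.Sets

/-! ### Pairs, sequences of sets and finite binary strings -/

variable {M}

/-- The code `(i + j)² + i` of the pair `(i, j)`. -/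
def pair (i j : M.Num) : M.Num := (i + j) * (i + j) + i

/-- The `i`-th member `{x | (x, i) ∈ A}` of the sequence of sets coded by `A`. -/
def row (A : Set M.Num) (i : M.Num) : Set M.Num := {x | pair x i ∈ A}

/-- A number `(l, (m, n))` describes the binary string of length `l` whose `i`-th entry, for
`i < l`, is `1` exactly if `m (i + 1) + 1` divides `n`. `HasLength σ l` says that the string
described by `σ` has length `l`. -/
def HasLength (σ l : M.Num) : Prop := ∃ m n : M.Num, σ = pair l (pair m n)

/-- The `i`-th entry of the string described by `σ` exists and is `1`. -/
def EntryOne (σ i : M.Num) : Prop :=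
  ∃ l m n : M.Num, σ = pair l (pair m n) ∧ i < l ∧ ∃ d : M.Num, n = (m * (i + 1) + 1) * d

/-- `σ` and `τ` describe the same string. -/
def SameString (σ τ : M.Num) : Prop :=
  ∃ l : M.Num, HasLength σ l ∧ HasLength τ l ∧ ∀ i, i < l → (EntryOne σ i ↔ EntryOne τ i)

/-- `σ` is (the code of) an element of `2^{<ℕ}`: the least number that describes a given
finite binary string. -/
def IsString (σ : M.Num) : Prop :=
  (∃ l : M.Num, HasLength σ l) ∧ ∀ τ : M.Num, τ < σ → ¬ SameString σ τ

/-- The string `τ` extends (not necessarily properly) the string `σ`. -/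
def Extends (τ σ : M.Num) : Prop :=
  ∃ l l' : M.Num, HasLength σ l ∧ HasLength τ l' ∧ (l < l' ∨ l = l') ∧
    ∀ i, i < l → (EntryOne σ i ↔ EntryOne τ i)

/-- `σ` is the string `G ↾ s`. -/
def IsRestriction (G : Set M.Num) (s σ : M.Num) : Prop :=
  IsString σ ∧ HasLength σ s ∧ ∀ i, i < s → (EntryOne σ i ↔ i ∈ G)

/-- `D` is dense in `2^{<ℕ}`. -/
def IsDense (D : M.Num → Prop) : Prop :=
  ∀ σ : M.Num, IsString σ → ∃ τ : M.Num, IsString τ ∧ Extends τ σ ∧ D τ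

/-! ### Families of sets -/

/-- `X` is a member of the family coded by `B`. -/
def InFamily (X B : Set M.Num) : Prop := ∃ i : M.Num, X = row B i

/-- Some member of the family coded by `A` is nonempty. -/
def IsNontrivial (A : Set M.Num) : Prop := ∃ i : M.Num, row A i ≠ ∅

/-- Every member of the family coded by `B` is a member of the family coded by `A`. -/
def IsSubfamily (B A : Set M.Num) : Prop := ∀ i : M.Num, InFamily (row B i) A

/-- `F` is a finite set of the structure. -/
def IsFiniteSet (F : Set M.Num) : Prop := F ∈ M.Sets ∧ ∃ b : M.Num, ∀ i ∈ F, i < b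

/-- The F intersection property of a subfamily `B` of the family `A = ⟨A_i⟩`: any `m ≥ 2`
distinct members `A_i`, `i ∈ F`, of `B` have nonempty intersection. (Every member of `B`
is one of the `A_i`; `m` is the size of the finite set `F`.) -/
def HasFIntersection (A B : Set M.Num) : Prop :=
  ∀ F : Set M.Num, IsFiniteSet F → (∃ i ∈ F, ∃ j ∈ F, i ≠ j) →
    (∀ i ∈ F, InFamily (row A i) B) →
    (∀ i ∈ F, ∀ j ∈ F, i ≠ j → row A i ≠ row A j) →
    ∃ x : M.Num, ∀ i ∈ F, x ∈ row A i

/-- `B` is a maximal subfamily of `A` with the F intersection property. -/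
def IsMaximalFSubfamily (A B : Set M.Num) : Prop :=
  IsSubfamily B A ∧ HasFIntersection A B ∧
    ∀ C ∈ M.Sets, IsSubfamily C A → HasFIntersection A C → IsSubfamily B C → IsSubfamily C B

variable (M)

/-! ### The two principles -/

/-- The principle `Π⁰₁G`: for any uniformly `Π⁰₁` collection of dense sets `D i` of strings
there is a set `G` such that for every `i` some `G ↾ s` is in `D i`. -/
def SatisfiesPi01G : Prop :=
  ∀ D : M.Num → M.Num → Prop, M.IsUniformlyPi01 D → (∀ i, IsDense (D i)) →
    ∃ G ∈ M.Sets, ∀ i : M.Num, ∃ s σ : M.Num, IsRestriction G s σ ∧ D i σ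

/-- The principle `FIP`: every nontrivial family of sets has a maximal subfamily with the
F intersection property. -/
def SatisfiesFIP : Prop :=
  ∀ A ∈ M.Sets, IsNontrivial A → ∃ B ∈ M.Sets, IsMaximalFSubfamily A B

end L2Structure

/-!
The proof is a forcing argument carried out inside a model `M` of `RCA₀`.

If some `A_i` is empty, then the subfamily whose only member is `∅` is maximal, because no
nonempty member can be added to it (`isMaximalFSubfamily_empty`). Suppose that all `A_i` are
nonempty. A number `t = ((i, x), k)` is read as the proposal to add `A_i` to the subfamily, with
`x` offered as an element of the resulting intersection. A set `G` accepts the proposals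
`t ∈ G` one after the other, and rejects those whose element `x` is not in `A_i` or not in one
of the sets proposed by the proposals accepted before `t`. For every `i` the strings along
which `A_i` gets proposed, or becomes disjoint from the intersection of the sets proposed so
far, form a dense set (`isDense_settles`), and these sets are uniformly `Π⁰₁`
(`isUniformlyPi01_settles`). A `G` that meets all of them yields the set `H` of accepted
proposals (`exists_maximal_proposals`). The sets proposed by `H` form a maximal subfamily
(`exists_isMaximalFSubfamily_of_nonempty`). For an index `i` of a member of the subfamily, `i`
itself is proposed by `H`, even if the member was proposed with another index; hence only `Σ⁰₁`
bounding is needed to see that finitely many members have a common element. For maximality,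
the members of a finite set of indices need not be distinct
(`HasFIntersection.exists_mem`), which follows from the least number principle for `Π⁰₁`
predicates.

The arithmetic behind this is developed from the axioms: bounded definability is closed under the
usual operations, so that predicates are recognized as `Σ⁰₀` by applying closure lemmas along
their syntax; `Σ⁰₁` induction gives least elements; every set of `M` has a code below every bound,
by the moduli of Gödel's `β` function (`exists_code`); and sets can be defined by
course-of-values recursion (`exists_recursive_set`).
-/

/-! ### Definability by bounded formulas -/

/-- Renaming of the variables of a number term. -/
def NumTerm.rename {n n' : ℕ} (ρ : Fin n → Fin n') : NumTerm n → NumTerm n'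
  | .var i => .var (ρ i)
  | .zero => .zero
  | .one => .one
  | .add s t => .add (s.rename ρ) (t.rename ρ)
  | .mul s t => .mul (s.rename ρ) (t.rename ρ)

/-- Renaming of the free number and set variables of a `Σ⁰₀` formula. -/
def SigmaZeroFormula.rename {k k' : ℕ} (κ : Fin k → Fin k') :
    {n n' : ℕ} → (Fin n → Fin n') → SigmaZeroFormula k n → SigmaZeroFormula k' n'
  | _, _, ρ, .eq s t => .eq (s.rename ρ) (t.rename ρ)
  | _, _, ρ, .lt s t => .lt (s.rename ρ) (t.rename ρ)
  | _, _, ρ, .mem t X => .mem (t.rename ρ) (κ X)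
  | _, _, ρ, .not φ => .not (φ.rename κ ρ)
  | _, _, ρ, .and φ ψ => .and (φ.rename κ ρ) (ψ.rename κ ρ)
  | _, _, ρ, .or φ ψ => .or (φ.rename κ ρ) (ψ.rename κ ρ)
  | _, _, ρ, .ball t φ => .ball (t.rename ρ) (φ.rename κ (Fin.cons 0 (Fin.succ ∘ ρ)))
  | _, _, ρ, .bex t φ => .bex (t.rename ρ) (φ.rename κ (Fin.cons 0 (Fin.succ ∘ ρ)))

theorem NumTerm.eval_rename (M : L2Structure.{u}) {n n' : ℕ} (ρ : Fin n → Fin n')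
    (t : NumTerm n) (v : Fin n' → M.Num) : (t.rename ρ).eval M v = t.eval M (v ∘ ρ) := by
  induction t with
  | var i => simp only [NumTerm.rename, NumTerm.eval, Function.comp]
  | zero => simp only [NumTerm.rename, NumTerm.eval]
  | one => simp only [NumTerm.rename, NumTerm.eval]
  | add s t hs ht => simp only [NumTerm.rename, NumTerm.eval, hs, ht]
  | mul s t hs ht => simp only [NumTerm.rename, NumTerm.eval, hs, ht]

theorem SigmaZeroFormula.holds_rename (M : L2Structure.{u}) {k k' : ℕ} (κ : Fin k → Fin k')
    {n : ℕ} (φ : SigmaZeroFormula k n) :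
    ∀ {n' : ℕ} (ρ : Fin n → Fin n') (v : Fin n' → M.Num) (W : Fin k' → Set M.Num),
      (φ.rename κ ρ).Holds M v W ↔ φ.Holds M (v ∘ ρ) (W ∘ κ) := by
  have key : ∀ {n n' : ℕ} (ρ : Fin n → Fin n') (v : Fin n' → M.Num) (x : M.Num),
      (Fin.cons x v : Fin (n' + 1) → M.Num) ∘ (Fin.cons 0 (Fin.succ ∘ ρ) : Fin (n + 1) → _)
        = (Fin.cons x (v ∘ ρ) : Fin (n + 1) → M.Num) := by
    intro n n' ρ v x
    funext i
    refine Fin.cases ?_ (fun i => ?_) i <;> simp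
  induction φ with
  | eq s t => intros; simp only [rename, Holds, NumTerm.eval_rename]
  | lt s t => intros; simp only [rename, Holds, NumTerm.eval_rename]
  | mem t X => intros; simp only [rename, Holds, NumTerm.eval_rename, Function.comp]
  | not φ h => intros; simp only [rename, Holds, h]
  | and φ ψ h h' => intros; simp only [rename, Holds, h, h']
  | or φ ψ h h' => intros; simp only [rename, Holds, h, h']
  | ball t φ h => intros; simp only [rename, Holds, NumTerm.eval_rename, h, key]
  | bex t φ h => intros; simp only [rename, Holds, NumTerm.eval_rename, h, key]

namespace L2Structure

/-- `f` is given by a number term with number parameters from `M`. -/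
def IsTerm {M : L2Structure.{u}} {m : ℕ} (f : (Fin m → M.Num) → M.Num) : Prop :=
  ∃ (n : ℕ) (t : NumTerm (m + n)) (v : Fin n → M.Num), ∀ a, f a = t.eval M (Fin.append a v)

section Definability

variable {M : L2Structure.{u}} {m : ℕ} {f g : (Fin m → M.Num) → M.Num}
  {P Q : (Fin m → M.Num) → Prop}

/-- The renaming that adds `n₂` parameters behind the first `n₁`. -/
def shiftLeft (m n₁ n₂ : ℕ) : Fin (m + n₁) → Fin (m + (n₁ + n₂)) :=
  Fin.addCases (Fin.castAdd _) (fun j => Fin.natAdd m (Fin.castAdd n₂ j))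

/-- The renaming that adds `n₁` parameters in front of the last `n₂`. -/
def shiftRight (m n₁ n₂ : ℕ) : Fin (m + n₂) → Fin (m + (n₁ + n₂)) :=
  Fin.addCases (Fin.castAdd _) (fun j => Fin.natAdd m (Fin.natAdd n₁ j))

/-- The variant of `shiftRight` for the body of a quantifier. -/
def shiftBody (m n₁ n₂ : ℕ) : Fin (m + 1 + n₂) → Fin (m + (n₁ + n₂) + 1) :=
  Fin.addCases (Fin.cons 0 (fun i => (Fin.castAdd _ i).succ))
    (fun j => (Fin.natAdd m (Fin.natAdd n₁ j)).succ)

theorem append_comp_shiftLeft {α : Type*} {n₁ n₂ : ℕ} (a : Fin m → α) (v₁ : Fin n₁ → α)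
    (v₂ : Fin n₂ → α) :
    Fin.append a (Fin.append v₁ v₂) ∘ shiftLeft m n₁ n₂ = Fin.append a v₁ := by
  funext i
  refine Fin.addCases (fun i => ?_) (fun i => ?_) i <;> simp [shiftLeft]

theorem append_comp_shiftRight {α : Type*} {n₁ n₂ : ℕ} (a : Fin m → α) (v₁ : Fin n₁ → α)
    (v₂ : Fin n₂ → α) :
    Fin.append a (Fin.append v₁ v₂) ∘ shiftRight m n₁ n₂ = Fin.append a v₂ := by
  funext i
  refine Fin.addCases (fun i => ?_) (fun i => ?_) i <;> simp [shiftRight]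

theorem append_comp_shiftBody {α : Type*} {n₁ n₂ : ℕ} (x : α) (a : Fin m → α)
    (v₁ : Fin n₁ → α) (v₂ : Fin n₂ → α) :
    (Fin.cons x (Fin.append a (Fin.append v₁ v₂)) : Fin (m + (n₁ + n₂) + 1) → α) ∘
      shiftBody m n₁ n₂ = Fin.append (Fin.cons x a : Fin (m + 1) → α) v₂ := by
  funext i
  refine Fin.addCases (fun i => ?_) (fun i => ?_) i
  · refine Fin.cases ?_ (fun i => ?_) i <;> simp [shiftBody]
  · simp [shiftBody]

theorem IsTerm.var (i : Fin m) : IsTerm (fun a : Fin m → M.Num => a i) :=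
  ⟨0, .var (Fin.castAdd 0 i), Fin.elim0, fun a => by simp [NumTerm.eval]⟩

theorem IsTerm.const (c : M.Num) : IsTerm (fun _ : Fin m → M.Num => c) :=
  ⟨1, .var (Fin.natAdd m 0), fun _ => c, fun a => by simp [NumTerm.eval]⟩

theorem IsTerm.tail (hf : IsTerm f) :
    IsTerm (fun b : Fin (m + 1) → M.Num => f (fun i => b i.succ)) := by
  obtain ⟨n, t, v, h⟩ := hf
  refine ⟨n, t.rename (Fin.addCases (fun i => Fin.castAdd n i.succ) (Fin.natAdd (m + 1))), v,
    fun b => ?_⟩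
  refine (h _).trans ?_
  rw [NumTerm.eval_rename]
  congr 1
  funext i
  refine Fin.addCases (fun i => ?_) (fun i => ?_) i <;> simp

theorem IsTerm.add (hf : IsTerm f) (hg : IsTerm g) : IsTerm (fun a => f a + g a) := by
  obtain ⟨n₁, t₁, v₁, h₁⟩ := hf
  obtain ⟨n₂, t₂, v₂, h₂⟩ := hg
  refine ⟨n₁ + n₂, .add (t₁.rename (shiftLeft m n₁ n₂)) (t₂.rename (shiftRight m n₁ n₂)),
    Fin.append v₁ v₂, fun a => ?_⟩
  simp only [NumTerm.eval, NumTerm.eval_rename, append_comp_shiftLeft, append_comp_shiftRight,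
    h₁, h₂]

theorem IsTerm.mul (hf : IsTerm f) (hg : IsTerm g) : IsTerm (fun a => f a * g a) := by
  obtain ⟨n₁, t₁, v₁, h₁⟩ := hf
  obtain ⟨n₂, t₂, v₂, h₂⟩ := hg
  refine ⟨n₁ + n₂, .mul (t₁.rename (shiftLeft m n₁ n₂)) (t₂.rename (shiftRight m n₁ n₂)),
    Fin.append v₁ v₂, fun a => ?_⟩
  simp only [NumTerm.eval, NumTerm.eval_rename, append_comp_shiftLeft, append_comp_shiftRight,
    h₁, h₂]

theorem IsTerm.pair (hf : IsTerm f) (hg : IsTerm g) :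
    IsTerm (fun a => pair (f a) (g a)) :=
  ((hf.add hg).mul (hf.add hg)).add hf

theorem IsSigma00.eq (hf : IsTerm f) (hg : IsTerm g) : M.IsSigma00 (fun a => f a = g a) := by
  obtain ⟨n₁, t₁, v₁, h₁⟩ := hf
  obtain ⟨n₂, t₂, v₂, h₂⟩ := hg
  refine ⟨0, n₁ + n₂, .eq (t₁.rename (shiftLeft m n₁ n₂)) (t₂.rename (shiftRight m n₁ n₂)),
    Fin.append v₁ v₂, Fin.elim0, fun i => i.elim0, fun a => ?_⟩
  simp only [SigmaZeroFormula.Holds, NumTerm.eval_rename, append_comp_shiftLeft,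
    append_comp_shiftRight, h₁, h₂]

theorem IsSigma00.lt (hf : IsTerm f) (hg : IsTerm g) : M.IsSigma00 (fun a => f a < g a) := by
  obtain ⟨n₁, t₁, v₁, h₁⟩ := hf
  obtain ⟨n₂, t₂, v₂, h₂⟩ := hg
  refine ⟨0, n₁ + n₂, .lt (t₁.rename (shiftLeft m n₁ n₂)) (t₂.rename (shiftRight m n₁ n₂)),
    Fin.append v₁ v₂, Fin.elim0, fun i => i.elim0, fun a => ?_⟩
  simp only [SigmaZeroFormula.Holds, NumTerm.eval_rename, append_comp_shiftLeft,
    append_comp_shiftRight, h₁, h₂]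

theorem IsSigma00.mem {X : Set M.Num} (hX : X ∈ M.Sets) (hf : IsTerm f) :
    M.IsSigma00 (fun a => f a ∈ X) := by
  obtain ⟨n, t, v, h⟩ := hf
  refine ⟨1, n, .mem t 0, v, fun _ => X, fun _ => hX, fun a => ?_⟩
  simp only [SigmaZeroFormula.Holds, h]

theorem IsSigma00.not (hP : M.IsSigma00 P) : M.IsSigma00 (fun a => ¬ P a) := by
  obtain ⟨k, n, θ, v, W, hW, h⟩ := hP
  refine ⟨k, n, .not θ, v, W, hW, fun a => ?_⟩
  simp only [SigmaZeroFormula.Holds, h]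

theorem append_mem_sets {k₁ k₂ : ℕ} {W₁ : Fin k₁ → Set M.Num} {W₂ : Fin k₂ → Set M.Num}
    (h₁ : ∀ i, W₁ i ∈ M.Sets) (h₂ : ∀ i, W₂ i ∈ M.Sets) (i : Fin (k₁ + k₂)) :
    Fin.append W₁ W₂ i ∈ M.Sets := by
  refine Fin.addCases (fun i => ?_) (fun i => ?_) i
  · rw [Fin.append_left]; exact h₁ i
  · rw [Fin.append_right]; exact h₂ i

theorem append_comp_castAdd {α : Type*} {k₁ k₂ : ℕ} (W₁ : Fin k₁ → α) (W₂ : Fin k₂ → α) :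
    Fin.append W₁ W₂ ∘ Fin.castAdd k₂ = W₁ := by
  funext i; simp

theorem append_comp_natAdd {α : Type*} {k₁ k₂ : ℕ} (W₁ : Fin k₁ → α) (W₂ : Fin k₂ → α) :
    Fin.append W₁ W₂ ∘ Fin.natAdd k₁ = W₂ := by
  funext i; simp

theorem IsSigma00.and (hP : M.IsSigma00 P) (hQ : M.IsSigma00 Q) :
    M.IsSigma00 (fun a => P a ∧ Q a) := by
  obtain ⟨k₁, n₁, θ₁, v₁, W₁, hW₁, h₁⟩ := hP
  obtain ⟨k₂, n₂, θ₂, v₂, W₂, hW₂, h₂⟩ := hQ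
  refine ⟨k₁ + k₂, n₁ + n₂, .and (θ₁.rename (Fin.castAdd k₂) (shiftLeft m n₁ n₂))
    (θ₂.rename (Fin.natAdd k₁) (shiftRight m n₁ n₂)), Fin.append v₁ v₂, Fin.append W₁ W₂,
    append_mem_sets hW₁ hW₂, fun a => ?_⟩
  simp only [SigmaZeroFormula.Holds, SigmaZeroFormula.holds_rename, append_comp_shiftLeft,
    append_comp_shiftRight, append_comp_castAdd, append_comp_natAdd, h₁, h₂]

theorem IsSigma00.congr (hP : M.IsSigma00 P) (h : ∀ a, Q a ↔ P a) : M.IsSigma00 Q := by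
  have : Q = P := funext fun a => propext (h a)
  rwa [this]

theorem IsSigma00.or (hP : M.IsSigma00 P) (hQ : M.IsSigma00 Q) :
    M.IsSigma00 (fun a => P a ∨ Q a) :=
  (hP.not.and hQ.not).not.congr fun a => by tauto

theorem IsSigma00.imp (hP : M.IsSigma00 P) (hQ : M.IsSigma00 Q) :
    M.IsSigma00 (fun a => P a → Q a) :=
  (hP.and hQ.not).not.congr fun a => by tauto

theorem IsSigma00.iff (hP : M.IsSigma00 P) (hQ : M.IsSigma00 Q) :
    M.IsSigma00 (fun a => P a ↔ Q a) :=
  ((hP.imp hQ).and (hQ.imp hP)).congr fun a => by tauto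

/-- Closure under bounded quantification. The hypothesis on the body speaks of the tuple that
begins with the bound variable. -/
theorem IsSigma00.ball {R : M.Num → (Fin m → M.Num) → Prop} (hf : IsTerm f)
    (hR : M.IsSigma00 (fun b : Fin (m + 1) → M.Num => R (b 0) (fun i => b i.succ))) :
    M.IsSigma00 (fun a => ∀ x, x < f a → R x a) := by
  obtain ⟨n₁, t, v₁, h₁⟩ := hf
  obtain ⟨k, n₂, θ, v₂, W, hW, h₂⟩ := hR
  refine ⟨k, n₁ + n₂, .ball (t.rename (shiftLeft m n₁ n₂)) (θ.rename id (shiftBody m n₁ n₂)),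
    Fin.append v₁ v₂, W, hW, fun a => ?_⟩
  have h₃ : ∀ x, R x a ↔ θ.Holds M (Fin.append (Fin.cons x a : Fin (m + 1) → M.Num) v₂) W :=
    fun x => by simpa using h₂ (Fin.cons x a)
  simp only [SigmaZeroFormula.Holds, SigmaZeroFormula.holds_rename, NumTerm.eval_rename,
    append_comp_shiftLeft, append_comp_shiftBody, Function.comp_id, h₁, h₃]

theorem IsSigma00.bex {R : M.Num → (Fin m → M.Num) → Prop} (hf : IsTerm f)
    (hR : M.IsSigma00 (fun b : Fin (m + 1) → M.Num => R (b 0) (fun i => b i.succ))) :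
    M.IsSigma00 (fun a => ∃ x, x < f a ∧ R x a) :=
  (IsSigma00.ball (R := fun x a => ¬ R x a) hf hR.not).not.congr fun a => by push Not; rfl

theorem IsSigma00.comp {m' : ℕ} (hP : M.IsSigma00 P) (ρ : Fin m → Fin m') :
    M.IsSigma00 (fun a : Fin m' → M.Num => P (fun i => a (ρ i))) := by
  obtain ⟨k, n, θ, v, W, hW, h⟩ := hP
  refine ⟨k, n, θ.rename id (Fin.addCases (fun i => Fin.castAdd n (ρ i)) (Fin.natAdd m')), v, W,
    hW, fun a => ?_⟩
  refine (h _).trans ?_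
  rw [SigmaZeroFormula.holds_rename, Function.comp_id]
  refine iff_of_eq (congrArg (fun u => θ.Holds M u W) ?_)
  funext i
  refine Fin.addCases (fun i => ?_) (fun i => ?_) i <;> simp

end Definability

/-! ### The ordered semiring of numbers -/

variable {M : L2Structure.{u}} [hM : Fact M.IsRCA0]

/-- The numbers of a model of `RCA₀` form a commutative semiring, with the given operations. -/
instance : CommSemiring M.Num where
  toAdd := M.add
  toMul := M.mul
  toZero := M.zero
  toOne := M.one
  add_assoc := hM.out.semiring.add_assoc
  zero_add x := by rw [hM.out.semiring.add_comm, hM.out.semiring.add_zero]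
  add_zero := hM.out.semiring.add_zero
  add_comm := hM.out.semiring.add_comm
  nsmul := nsmulRec
  left_distrib := hM.out.semiring.mul_add
  right_distrib x y z := by
    rw [hM.out.semiring.mul_comm, hM.out.semiring.mul_add, hM.out.semiring.mul_comm x,
      hM.out.semiring.mul_comm y]
  zero_mul x := by rw [hM.out.semiring.mul_comm, hM.out.semiring.mul_zero]
  mul_zero := hM.out.semiring.mul_zero
  mul_assoc := hM.out.semiring.mul_assoc
  one_mul x := by rw [hM.out.semiring.mul_comm, hM.out.semiring.mul_one]
  mul_one := hM.out.semiring.mul_one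
  mul_comm := hM.out.semiring.mul_comm

/-- The numbers of a model of `RCA₀` are linearly ordered, with the given strict order. -/
noncomputable instance : LinearOrder M.Num where
  le x y := x < y ∨ x = y
  toLT := M.lt
  le_refl x := Or.inr rfl
  le_trans x y z h h' := by
    rcases h with h | rfl
    · rcases h' with h' | rfl
      · exact Or.inl (hM.out.semiring.lt_trans _ _ _ h h')
      · exact Or.inl h
    · exact h'
  le_antisymm x y h h' := by
    rcases h with h | h
    · rcases h' with h' | h'
      · exact absurd (hM.out.semiring.lt_trans _ _ _ h h') (hM.out.semiring.lt_irrefl _)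
      · exact h'.symm
    · exact h
  lt_iff_le_not_ge x y := by
    constructor
    · refine fun h => ⟨Or.inl h, ?_⟩
      rintro (h' | rfl)
      · exact hM.out.semiring.lt_irrefl _ (hM.out.semiring.lt_trans _ _ _ h h')
      · exact hM.out.semiring.lt_irrefl _ h
    · rintro ⟨h | rfl, h'⟩
      · exact h
      · exact absurd (Or.inr rfl) h'
  le_total x y := by
    rcases hM.out.semiring.lt_trichotomy x y with h | h | h
    · exact Or.inl (Or.inl h)
    · exact Or.inl (Or.inr h)
    · exact Or.inr (Or.inl h)
  toDecidableLE := Classical.decRel _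

instance : IsStrictOrderedRing M.Num where
  add_le_add_left x y h z := by
    rcases h with h | rfl
    · exact Or.inl (hM.out.semiring.add_lt_add _ _ _ h)
    · exact le_rfl
  le_of_add_le_add_left x y z h := by
    by_contra hlt
    have h' := hM.out.semiring.add_lt_add _ _ x (not_le.mp hlt)
    rw [add_comm z, add_comm y] at h'
    exact absurd h (not_le.mpr h')
  zero_le_one := Or.inl hM.out.semiring.zero_lt_one
  exists_pair_ne := ⟨0, 1, ne_of_lt hM.out.semiring.zero_lt_one⟩
  mul_lt_mul_of_pos_left x hx y z h := by
    rw [mul_comm x, mul_comm x]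
    exact hM.out.semiring.mul_lt_mul _ _ _ hx h
  mul_lt_mul_of_pos_right x hx y z h := hM.out.semiring.mul_lt_mul _ _ _ hx h

instance : CanonicallyOrderedAdd M.Num where
  exists_add_of_le {x y} h := by
    rcases h with h | rfl
    · obtain ⟨z, hz⟩ := hM.out.semiring.exists_add_of_lt _ _ h
      exact ⟨z, hz.symm⟩
    · exact ⟨0, (add_zero _).symm⟩
  le_add_self x y := by
    rcases hM.out.semiring.eq_zero_or_pos y with h | h
    · rw [h, zero_add]
    · have := hM.out.semiring.add_lt_add _ _ x h
      rw [zero_add] at this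
      exact Or.inl this
  le_self_add x y := by
    rcases hM.out.semiring.eq_zero_or_pos y with h | h
    · rw [h, add_zero]
    · have := hM.out.semiring.add_lt_add _ _ x h
      rw [zero_add, add_comm] at this
      exact Or.inl this


theorem lt_add_one_iff {x y : M.Num} : x < y + 1 ↔ x ≤ y := by
  constructor
  · intro h
    by_contra hlt
    obtain ⟨z, rfl⟩ := exists_add_of_le (not_le.mp hlt).le
    rcases hM.out.semiring.eq_zero_or_pos z with rfl | hz
    · simp at hlt
    · have h1 : z < 1 := by simpa using h
      rcases hM.out.semiring.one_le_of_pos z hz with rfl | hz'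
      · exact lt_irrefl _ h1
      · exact lt_asymm h1 hz'
  · intro h
    exact lt_of_le_of_lt h (lt_add_of_pos_right _ zero_lt_one)

theorem add_one_le_iff {x y : M.Num} : x + 1 ≤ y ↔ x < y := by
  rw [← not_lt, lt_add_one_iff, not_le]

theorem lt_self_add_one (x : M.Num) : x < x + 1 := lt_add_one_iff.mpr le_rfl

theorem IsSigma00.ball_le {m : ℕ} {f : (Fin m → M.Num) → M.Num}
    {R : M.Num → (Fin m → M.Num) → Prop} (hf : IsTerm f)
    (hR : M.IsSigma00 (fun b : Fin (m + 1) → M.Num => R (b 0) (fun i => b i.succ))) :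
    M.IsSigma00 (fun a => ∀ x, x ≤ f a → R x a) :=
  (IsSigma00.ball (hf.add (.const 1)) hR).congr fun a => by simp only [lt_add_one_iff]

theorem IsSigma00.bex_le {m : ℕ} {f : (Fin m → M.Num) → M.Num}
    {R : M.Num → (Fin m → M.Num) → Prop} (hf : IsTerm f)
    (hR : M.IsSigma00 (fun b : Fin (m + 1) → M.Num => R (b 0) (fun i => b i.succ))) :
    M.IsSigma00 (fun a => ∃ x, x ≤ f a ∧ R x a) :=
  (IsSigma00.bex (hf.add (.const 1)) hR).congr fun a => by simp only [lt_add_one_iff]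

theorem le_mul_of_pos {x y : M.Num} (h : 0 < x) : y ≤ x * y :=
  le_mul_of_one_le_left zero_le (by simpa using add_one_le_iff.mpr h)

theorem IsSigma00.dvd {m : ℕ} {f g : (Fin m → M.Num) → M.Num} (hf : IsTerm f) (hg : IsTerm g) :
    M.IsSigma00 (fun a => f a ∣ g a) := by
  refine (IsSigma00.bex_le (R := fun x a => g a = f a * x) hg ?_).congr fun a => ?_
  · exact .eq hg.tail (hf.tail.mul (.var 0))
  · constructor
    · rintro ⟨x, hx⟩
      rcases hM.out.semiring.eq_zero_or_pos (f a) with h | h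
      · exact ⟨0, zero_le, by rw [hx, h, zero_mul, mul_zero]⟩
      · exact ⟨x, hx ▸ le_mul_of_pos h, hx⟩
    · rintro ⟨x, -, hx⟩
      exact ⟨x, hx⟩

/-! ### Comprehension, induction and least elements -/

theorem exists₂_iff_bounded {R : M.Num → M.Num → Prop} :
    (∃ y z, R y z) ↔ ∃ w, ∃ y, y ≤ w ∧ ∃ z, z ≤ w ∧ R y z :=
  ⟨fun ⟨y, z, h⟩ => ⟨max y z, y, le_max_left _ _, z, le_max_right _ _, h⟩,
    fun ⟨_, y, _, z, _, h⟩ => ⟨y, z, h⟩⟩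

theorem forall₂_iff_bounded {R : M.Num → M.Num → Prop} :
    (∀ y z, R y z) ↔ ∀ w, ∀ y, y ≤ w → ∀ z, z ≤ w → R y z :=
  ⟨fun h _ y _ z _ => h y z,
    fun h y z => h (max y z) y (le_max_left _ _) z (le_max_right _ _)⟩

theorem setOf_exists_mem_sets {R S : M.Num → M.Num → Prop}
    (hR : M.IsSigma00 (fun a : Fin 2 → M.Num => R (a 0) (a 1)))
    (hS : M.IsSigma00 (fun a : Fin 2 → M.Num => S (a 0) (a 1)))
    (h : ∀ x, (∃ y, R x y) ↔ ∀ y, S x y) : {x | ∃ y, R x y} ∈ M.Sets :=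
  hM.out.delta01_comprehension (fun x => ∃ y, R x y) (fun x => ∀ y, S x y)
    ⟨_, hR, fun x => by simp⟩ ⟨_, hS, fun x => by simp⟩ h

theorem setOf_mem_sets {P : M.Num → Prop}
    (hP : M.IsSigma00 (fun a : Fin 1 → M.Num => P (a 0))) : {x | P x} ∈ M.Sets := by
  have h2 : M.IsSigma00 (fun a : Fin 2 → M.Num => P (a 0)) := hP.comp ![0]
  have := setOf_exists_mem_sets (R := fun x _ => P x) (S := fun x _ => P x) h2 h2
    (fun x => by simp)
  simpa using this

theorem sigma01_induction {R : M.Num → M.Num → Prop}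
    (hR : M.IsSigma00 (fun a : Fin 2 → M.Num => R (a 0) (a 1))) (zero : ∃ y, R 0 y)
    (succ : ∀ x, (∃ y, R x y) → ∃ y, R (x + 1) y) (x : M.Num) : ∃ y, R x y :=
  hM.out.sigma01_induction (fun x => ∃ y, R x y) ⟨_, hR, fun x => by simp⟩ zero succ x

/-- The least number principle for `Π⁰₁` predicates. If no least `x` exists, then `Σ⁰₁`
induction on `b` gives a common bound for the counterexamples to `R x` for all `x < b`. -/
theorem exists_least_forall {R : M.Num → M.Num → Prop}
    (hR : M.IsSigma00 (fun a : Fin 2 → M.Num => R (a 0) (a 1))) (h : ∃ x, ∀ y, R x y) :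
    ∃ x, (∀ y, R x y) ∧ ∀ x', x' < x → ¬ ∀ y, R x' y := by
  by_contra hno
  push Not at hno
  obtain ⟨x₀, hx₀⟩ := h
  -- The bound `w` keeps the induction formula `Σ⁰₁`.
  have key : ∀ b : M.Num, ∃ w, ∀ x, x < b → ∃ y, y < w ∧ ¬ R x y := by
    refine sigma01_induction
      (.ball (.var 0) (.bex (.var 2) (.not (hR.comp ![1, 0])))) ?_ ?_
    · exact ⟨0, fun x hx => absurd hx not_lt_zero⟩
    · rintro b ⟨w, hw⟩
      have hb : ∃ y, ¬ R b y := by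
        by_contra hb
        push Not at hb
        obtain ⟨x, hxb, hx⟩ := hno b hb
        obtain ⟨y, -, hy⟩ := hw x hxb
        exact hy (hx y)
      obtain ⟨y, hy⟩ := hb
      refine ⟨max w (y + 1), fun x hx => ?_⟩
      rcases (lt_add_one_iff.mp hx).lt_or_eq with hx | rfl
      · obtain ⟨z, hz, hz'⟩ := hw x hx
        exact ⟨z, lt_max_of_lt_left hz, hz'⟩
      · exact ⟨y, lt_max_of_lt_right (lt_self_add_one y), hy⟩
  obtain ⟨w, hw⟩ := key (x₀ + 1)
  obtain ⟨y, -, hy⟩ := hw x₀ (lt_self_add_one _)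
  exact hy (hx₀ y)

theorem exists_least {P : M.Num → Prop}
    (hP : M.IsSigma00 (fun a : Fin 1 → M.Num => P (a 0))) (h : ∃ x, P x) :
    ∃ x, P x ∧ ∀ x', x' < x → ¬ P x' := by
  have := exists_least_forall (R := fun x _ => P x) (hP.comp (m' := 2) ![0]) (by simpa using h)
  simpa using this

theorem strong_induction {P : M.Num → Prop}
    (hP : M.IsSigma00 (fun a : Fin 1 → M.Num => P (a 0)))
    (h : ∀ x, (∀ y, y < x → P y) → P x) (x : M.Num) : P x := by
  by_contra hx
  obtain ⟨y, hy, hlt⟩ := exists_least (P := fun x => ¬ P x) hP.not ⟨x, hx⟩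
  exact hy (h y fun z hz => not_not.mp (hlt z hz))

/-! ### Pairs -/

theorem le_self_mul_self (x : M.Num) : x ≤ x * x := by
  rcases hM.out.semiring.eq_zero_or_pos x with rfl | h
  · exact zero_le
  · exact le_mul_of_pos h

theorem left_le_pair (i j : M.Num) : i ≤ pair i j := le_add_self

theorem right_le_pair (i j : M.Num) : j ≤ pair i j :=
  (le_add_self.trans (le_self_mul_self (i + j))).trans le_self_add

theorem pair_inj {i j i' j' : M.Num} : pair i j = pair i' j' ↔ i = i' ∧ j = j' := by
  refine ⟨fun h => ?_, fun ⟨h, h'⟩ => by rw [h, h']⟩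
  -- `pair i j` lies between the squares of `i + j` and `i + j + 1`.
  have key : ∀ i j i' j' : M.Num, i + j < i' + j' → pair i j < pair i' j' := by
    intro i j i' j' hlt
    have h1 : (i + j + 1) * (i + j + 1) ≤ (i' + j') * (i' + j') :=
      mul_le_mul' (add_one_le_iff.mpr hlt) (add_one_le_iff.mpr hlt)
    have h2 : pair i j < (i + j + 1) * (i + j + 1) := by
      have : (i + j + 1) * (i + j + 1) = pair i j + (i + j + j) + 1 := by
        unfold pair; ring
      rw [this, lt_add_one_iff]
      exact le_self_add
    exact (h2.trans_le h1).trans_le le_self_add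
  have hs : i + j = i' + j' := by
    rcases lt_trichotomy (i + j) (i' + j') with hlt | heq | hlt
    · exact absurd h (key _ _ _ _ hlt).ne
    · exact heq
    · exact absurd h (key _ _ _ _ hlt).ne'
  have hi : i = i' := by
    unfold pair at h
    rw [hs] at h
    exact add_left_cancel h
  subst hi
  exact ⟨rfl, add_left_cancel hs⟩

/-! ### Codes of bounded sets -/

/-- The pair `m, n` codes the set of those `i` for which `m (i + 1) + 1` divides `n`. This is
the coding of the entries of a string. -/
def CodedMem (m n i : M.Num) : Prop := m * (i + 1) + 1 ∣ n

theorem IsSigma00.codedMem {k : ℕ} {f g h : (Fin k → M.Num) → M.Num} (hf : IsTerm f)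
    (hg : IsTerm g) (hh : IsTerm h) :
    M.IsSigma00 (fun a => CodedMem (f a) (g a) (h a)) :=
  .dvd ((hf.mul (hh.add (.const 1))).add (.const 1)) hg

/-- `b` is invertible modulo `a`: this is `b w - a v = 1`, with a further multiple of `a` on the
left so that no subtraction is needed to find the witnesses. -/
def InvertibleMod (a b : M.Num) : Prop := ∃ w r v : M.Num, b * w + a * r = a * v + 1

theorem dvd_of_dvd_add_mul {a x y : M.Num} (h : a ∣ x + a * y) : a ∣ x := by
  obtain ⟨z, hz⟩ := h
  rcases le_total y z with hyz | hyz
  · obtain ⟨t, rfl⟩ := exists_add_of_le hyz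
    refine ⟨t, add_right_cancel (b := a * y) ?_⟩
    rw [hz]; ring
  · obtain ⟨t, rfl⟩ := exists_add_of_le hyz
    have : x + a * t = 0 := add_right_cancel (b := a * z) (by
      rw [zero_add]; exact Eq.trans (by ring) hz)
    rw [(add_eq_zero.mp this).1]
    exact dvd_zero a

/-- Euclid's lemma. -/
theorem InvertibleMod.dvd_of_dvd_mul {a b n : M.Num} (h : InvertibleMod a b) (hd : a ∣ b * n) :
    a ∣ n := by
  obtain ⟨w, r, v, h⟩ := h
  obtain ⟨t, ht⟩ := hd
  refine dvd_of_dvd_add_mul (y := v * n) ⟨t * w + r * n, ?_⟩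
  calc n + a * (v * n) = (a * v + 1) * n := by ring
    _ = (b * n) * w + a * r * n := by rw [← h]; ring
    _ = a * (t * w + r * n) := by rw [ht]; ring

/-- The moduli of Gödel's `β` function are pairwise coprime: modulo `m (i + 1) + 1` the product
`m (i + 1)` is `-1`, so every divisor of `m` is invertible, and the moduli for `i` and `j`
differ by `m (j - i)`. -/
theorem invertibleMod_modulus {c m i j : M.Num} (hm : 0 < m)
    (hdvd : ∀ k, k ≤ c → 0 < k → k ∣ m) (hi : i < c) (hj : j < c) (hij : i ≠ j) :
    InvertibleMod (m * (i + 1) + 1) (m * (j + 1) + 1) := by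
  obtain ⟨q, hq⟩ : ∃ q, m * (i + 1) = q + 1 := by
    obtain ⟨q, hq⟩ := exists_add_of_le (add_one_le_iff.mpr
      (show 0 < m * (i + 1) from mul_pos hm (lt_of_le_of_lt zero_le (lt_self_add_one i))))
    exact ⟨q, by rw [hq]; ring⟩
  rcases lt_or_gt_of_ne hij with h | h
  · obtain ⟨e, rfl⟩ := exists_add_of_le h.le
    have he : 0 < e := by simpa using h
    obtain ⟨f, hf⟩ := hdvd e (le_add_self.trans hj.le) he
    refine ⟨f * (i + 1) * (i + 1), 0, f * (i + 1) * (i + 1) + q, ?_⟩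
    calc _ = (m * (i + 1) + 1) * (f * (i + 1) * (i + 1)) + (m * (i + 1)) * (e * f * (i + 1)) := by
          ring
      _ = (m * (i + 1) + 1) * (f * (i + 1) * (i + 1)) + (m * (i + 1)) * (m * (i + 1)) := by
          rw [← hf]
      _ = _ := by rw [hq]; ring
  · obtain ⟨e, rfl⟩ := exists_add_of_le h.le
    have he : 0 < e := by simpa using h
    obtain ⟨f, hf⟩ := hdvd e (le_add_self.trans hi.le) he
    set p := m * (j + e + 1) with hp
    have hw : m * e * (f * (j + e + 1) * (j + e + 1)) = p * p := by
      calc _ = m * (j + e + 1) * (e * f * (j + e + 1)) := by ring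
        _ = p * p := by rw [← hf]
    refine ⟨f * (j + e + 1) * (j + e + 1) * p, q * q + q + 1,
      f * (j + e + 1) * (j + e + 1) * p, ?_⟩
    have hsum : p + 1 = m * (j + 1) + 1 + m * e := by rw [hp]; ring
    calc _ = (m * (j + 1) + 1) * (f * (j + e + 1) * (j + e + 1) * p)
            + (p + 1) * (q * q + q + 1) := rfl
      _ = (m * (j + 1) + 1) * (f * (j + e + 1) * (j + e + 1) * p) + p * p * p + 1 := by
          rw [hq]; ring
      _ = _ := by rw [hsum, ← hw]; ring

theorem exists_common_multiple (c : M.Num) :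
    ∃ m : M.Num, 0 < m ∧ ∀ k, k ≤ c → 0 < k → k ∣ m := by
  refine sigma01_induction (R := fun c m => 0 < m ∧ ∀ k, k ≤ c → 0 < k → k ∣ m)
    (.and (.lt (.const 0) (.var 1))
      (.ball_le (.var 0) (.imp (.lt (.const 0) (.var 0)) (.dvd (.var 0) (.var 2))))) ?_ ?_ c
  · exact ⟨1, zero_lt_one, fun k hk hk' => absurd hk' (not_lt_of_ge hk)⟩
  · rintro c ⟨m, hm, h⟩
    refine ⟨m * (c + 1), mul_pos hm (lt_of_le_of_lt zero_le (lt_self_add_one c)),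
      fun k hk hk' => ?_⟩
    rcases hk.lt_or_eq with hk | rfl
    · exact (h k (lt_add_one_iff.mp hk) hk').mul_right _
    · exact dvd_mul_left _ _

/-- Every set of the structure has, below every `c`, a code with coprime moduli. -/
theorem exists_code {X : Set M.Num} (hX : X ∈ M.Sets) (c : M.Num) :
    ∃ m n : M.Num, 0 < m ∧ 0 < n ∧
      (∀ i, i < c → ∀ j, j < c → i ≠ j → InvertibleMod (m * (i + 1) + 1) (m * (j + 1) + 1)) ∧
      ∀ i, i < c → (CodedMem m n i ↔ i ∈ X) := by
  obtain ⟨m, hm, hdvd⟩ := exists_common_multiple c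
  have hinv : ∀ i, i < c → ∀ j, j < c → i ≠ j →
      InvertibleMod (m * (i + 1) + 1) (m * (j + 1) + 1) :=
    fun i hi j hj hij => invertibleMod_modulus hm hdvd hi hj hij
  -- The code is the product of the moduli of the elements of `X`.
  have key : ∀ s : M.Num, ∃ n, 0 < n ∧ ∀ i, i < c → (CodedMem m n i ↔ i ∈ X ∧ i < s) := by
    refine sigma01_induction
      (R := fun s n => 0 < n ∧ ∀ i, i < c → (CodedMem m n i ↔ i ∈ X ∧ i < s))
      (.and (.lt (.const 0) (.var 1)) (.ball (.const c)
        (.iff (.codedMem (.const m) (.var 2) (.var 0))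
          (.and (.mem hX (.var 0)) (.lt (.var 0) (.var 1)))))) ?_ ?_
    · refine ⟨1, zero_lt_one, fun i _ => ⟨fun h => ?_, fun h => absurd h.2 not_lt_zero⟩⟩
      obtain ⟨d, hd⟩ := h
      have hd0 : 0 < d := by
        rcases hM.out.semiring.eq_zero_or_pos d with rfl | h
        · simp at hd
        · exact h
      have h1 : 1 < m * (i + 1) + 1 := by
        rw [lt_add_one_iff, ← zero_add (1 : M.Num), add_one_le_iff, zero_add]
        exact mul_pos hm (lt_of_le_of_lt zero_le (lt_self_add_one i))
      have h2 : m * (i + 1) + 1 ≤ 1 := by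
        conv_rhs => rw [hd, mul_comm]
        exact le_mul_of_pos hd0
      exact absurd h1 (not_lt_of_ge h2)
    · rintro s ⟨n, hn, h⟩
      by_cases hs : s < c ∧ s ∈ X
      · refine ⟨(m * (s + 1) + 1) * n,
          mul_pos (lt_of_le_of_lt zero_le (lt_self_add_one _)) hn, fun i hi => ?_⟩
        by_cases his : i = s
        · subst his
          exact ⟨fun _ => ⟨hs.2, lt_self_add_one i⟩, fun _ => dvd_mul_right _ _⟩
        · have : CodedMem m ((m * (s + 1) + 1) * n) i ↔ CodedMem m n i :=
            ⟨fun h => (hinv i hi s hs.1 his).dvd_of_dvd_mul h, fun h => h.mul_left _⟩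
          rw [this, h i hi, lt_add_one_iff, le_iff_lt_or_eq, or_iff_left his]
      · refine ⟨n, hn, fun i hi => ?_⟩
        rw [h i hi, lt_add_one_iff, le_iff_lt_or_eq]
        constructor
        · exact fun h => ⟨h.1, Or.inl h.2⟩
        · rintro ⟨h1, h2 | rfl⟩
          · exact ⟨h1, h2⟩
          · exact absurd ⟨hi, h1⟩ hs
  obtain ⟨n, hn, h⟩ := key c
  exact ⟨m, n, hm, hn, hinv, fun i hi => by rw [h i hi, and_iff_left hi]⟩

/-! ### Binary strings -/

theorem entryOne_pair {l m n i : M.Num} :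
    EntryOne (pair l (pair m n)) i ↔ i < l ∧ CodedMem m n i := by
  constructor
  · rintro ⟨l', m', n', h, hi, hd⟩
    obtain ⟨rfl, h'⟩ := pair_inj.mp h
    obtain ⟨rfl, rfl⟩ := pair_inj.mp h'
    exact ⟨hi, hd⟩
  · rintro ⟨hi, hd⟩
    exact ⟨l, m, n, rfl, hi, hd⟩

theorem HasLength.unique {σ l l' : M.Num} (h : HasLength σ l) (h' : HasLength σ l') : l = l' := by
  obtain ⟨m, n, rfl⟩ := h
  obtain ⟨m', n', h'⟩ := h'
  exact (pair_inj.mp h').1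

theorem IsSigma00.hasLength {k : ℕ} {f g : (Fin k → M.Num) → M.Num} (hf : IsTerm f)
    (hg : IsTerm g) : M.IsSigma00 (fun a => HasLength (f a) (g a)) := by
  refine (IsSigma00.bex_le (R := fun m a => ∃ n, n ≤ f a ∧ f a = pair (g a) (pair m n)) hf
    (.bex_le hf.tail (.eq hf.tail.tail
      (hg.tail.tail.pair (.pair (.var 1) (.var 0)))))).congr fun a => ?_
  constructor
  · rintro ⟨m, n, h⟩
    rw [h]
    exact ⟨m, (left_le_pair m n).trans (right_le_pair _ _), n,
      (right_le_pair m n).trans (right_le_pair _ _), rfl⟩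
  · rintro ⟨m, -, n, -, h⟩
    exact ⟨m, n, h⟩

theorem IsSigma00.entryOne {k : ℕ} {f g : (Fin k → M.Num) → M.Num} (hf : IsTerm f)
    (hg : IsTerm g) : M.IsSigma00 (fun a => EntryOne (f a) (g a)) := by
  refine (IsSigma00.bex_le (R := fun l a => ∃ m, m ≤ f a ∧ ∃ n, n ≤ f a ∧
    f a = pair l (pair m n) ∧ g a < l ∧ CodedMem m n (g a)) hf
    (.bex_le hf.tail (.bex_le hf.tail.tail (.and (.eq hf.tail.tail.tail
      (.pair (.var 2) (.pair (.var 1) (.var 0)))) (.and (.lt hg.tail.tail.tail (.var 2))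
      (.codedMem (.var 1) (.var 0) hg.tail.tail.tail)))))).congr fun a => ?_
  constructor
  · rintro ⟨l, m, n, h, hl, hd⟩
    rw [h]
    exact ⟨l, left_le_pair _ _, m, (left_le_pair m n).trans (right_le_pair _ _), n,
      (right_le_pair m n).trans (right_le_pair _ _), rfl, hl, hd⟩
  · rintro ⟨l, -, m, -, n, -, h, hl, hd⟩
    exact ⟨l, m, n, h, hl, hd⟩

theorem exists_isString {X : Set M.Num} (hX : X ∈ M.Sets) (l : M.Num) :
    ∃ σ : M.Num, IsString σ ∧ HasLength σ l ∧ ∀ i, i < l → (EntryOne σ i ↔ i ∈ X) := by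
  obtain ⟨m, n, -, -, -, h⟩ := exists_code hX l
  obtain ⟨σ, ⟨hl, hσ⟩, hlt⟩ := exists_least
    (P := fun σ => HasLength σ l ∧ ∀ i, i < l → (EntryOne σ i ↔ i ∈ X))
    (.and (.hasLength (.var 0) (.const l)) (.ball (.const l)
      (.iff (.entryOne (.var 1) (.var 0)) (.mem hX (.var 0)))))
    ⟨pair l (pair m n), ⟨m, n, rfl⟩, fun i hi => by rw [entryOne_pair, and_iff_right hi, h i hi]⟩
  refine ⟨σ, ⟨⟨l, hl⟩, fun τ hτ hsame => hlt τ hτ ?_⟩, hl, hσ⟩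
  obtain ⟨l', h1, h2, h3⟩ := hsame
  obtain rfl := hl.unique h1
  exact ⟨h2, fun i hi => (h3 i hi).symm.trans (hσ i hi)⟩

/-! ### Course-of-values recursion -/

/-- Two predicates that satisfy below `s` the same recursion agree below `s`. -/
theorem recursion_unique {Φ : (M.Num → Prop) → M.Num → Prop} {X Y : M.Num → Prop} {s : M.Num}
    (hX : M.IsSigma00 (fun a : Fin 1 → M.Num => X (a 0)))
    (hY : M.IsSigma00 (fun a : Fin 1 → M.Num => Y (a 0)))
    (hloc : ∀ t, (∀ u, u < t → (X u ↔ Y u)) → (Φ X t ↔ Φ Y t))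
    (hXΦ : ∀ t, t < s → (X t ↔ Φ X t)) (hYΦ : ∀ t, t < s → (Y t ↔ Φ Y t)) :
    ∀ t, t < s → (X t ↔ Y t) := by
  refine strong_induction (P := fun t => t < s → (X t ↔ Y t))
    (.imp (.lt (.var 0) (.const s)) (.iff hX hY)) fun t ih ht => ?_
  rw [hXΦ t ht, hYΦ t ht]
  exact hloc t fun u hu => ih u hu (hu.trans ht)

/-- Course-of-values recursion for sets: if the truth of `Φ X t` depends only on the part of `X`
below `t`, then some set `H` satisfies `t ∈ H ↔ Φ H t`. It is `Δ⁰₁` because the codes of its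
initial segments are recognized by a bounded formula. -/
theorem exists_recursive_set {Φ : (M.Num → Prop) → M.Num → Prop}
    (hΦ : M.IsSigma00 (fun a : Fin 3 → M.Num => Φ (CodedMem (a 0) (a 1)) (a 2)))
    (hloc : ∀ X Y t, (∀ u, u < t → (X u ↔ Y u)) → (Φ X t ↔ Φ Y t)) :
    ∃ H ∈ M.Sets, ∀ t, t ∈ H ↔ Φ (· ∈ H) t := by
  let Hist (m n s : M.Num) : Prop := ∀ t, t < s → (CodedMem m n t ↔ Φ (CodedMem m n) t)
  have hHist : M.IsSigma00 (fun a : Fin 3 → M.Num => Hist (a 0) (a 1) (a 2)) :=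
    .ball (.var 2) (.iff (.codedMem (.var 1) (.var 2) (.var 0)) (hΦ.comp ![1, 2, 0]))
  have hunique : ∀ m n m' n' s, Hist m n s → Hist m' n' s → ∀ t, t < s →
      (CodedMem m n t ↔ CodedMem m' n' t) := fun m n m' n' s h h' =>
    recursion_unique (.codedMem (.const m) (.const n) (.var 0))
      (.codedMem (.const m') (.const n') (.var 0)) (hloc _ _) h h'
  have hexists : ∀ s, ∃ m n, Hist m n s := by
    intro s
    rw [exists₂_iff_bounded]
    refine sigma01_induction (R := fun s w => ∃ m, m ≤ w ∧ ∃ n, n ≤ w ∧ Hist m n s)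
      (.bex_le (.var 1) (.bex_le (.var 2) (hHist.comp ![1, 0, 2]))) ?_ ?_ s
    · exact ⟨0, 0, le_rfl, 0, le_rfl, fun t ht => absurd ht not_lt_zero⟩
    · intro s hs
      rw [← exists₂_iff_bounded] at hs ⊢
      obtain ⟨m, n, h⟩ := hs
      have hX : {t | (t < s ∧ CodedMem m n t) ∨ (t = s ∧ Φ (CodedMem m n) s)} ∈ M.Sets :=
        setOf_mem_sets (.or (.and (.lt (.var 0) (.const s))
          (.codedMem (.const m) (.const n) (.var 0)))
          (.and (.eq (.var 0) (.const s)) (by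
            by_cases hs : Φ (CodedMem m n) s
            · exact (IsSigma00.eq (.const 0) (.const 0)).congr fun a => by simp [hs]
            · exact (IsSigma00.eq (.const 0) (.const 0)).not.congr fun a => by simp [hs])))
      obtain ⟨m', n', -, -, -, h'⟩ := exists_code hX (s + 1)
      have hagree : ∀ t, t < s → (CodedMem m' n' t ↔ CodedMem m n t) := by
        intro t ht
        rw [h' t (ht.trans (lt_self_add_one s))]
        simp [ht, ht.ne]
      refine ⟨m', n', fun t ht => ?_⟩
      rcases (lt_add_one_iff.mp ht).lt_or_eq with hts | rfl
      · rw [hagree t hts, h t hts]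
        exact hloc _ _ _ fun u hu => (hagree u (hu.trans hts)).symm
      · rw [h' t ht]
        simpa using hloc _ _ _ fun u hu => (hagree u hu).symm
  have hΔ : ∀ t, (∃ m n, Hist m n (t + 1) ∧ CodedMem m n t) ↔
      ∀ m n, Hist m n (t + 1) → CodedMem m n t := by
    intro t
    constructor
    · rintro ⟨m, n, h, ht⟩ m' n' h'
      exact (hunique _ _ _ _ _ h h' t (lt_self_add_one t)).mp ht
    · intro h
      obtain ⟨m, n, h'⟩ := hexists (t + 1)
      exact ⟨m, n, h', h m n h'⟩
  have hHist' : M.IsSigma00 (fun a : Fin 4 → M.Num => Hist (a 1) (a 0) (a 2 + 1)) :=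
    (IsSigma00.ball (R := fun t a => CodedMem (a 1) (a 0) t ↔ Φ (CodedMem (a 1) (a 0)) t)
      ((IsTerm.var 2).add (.const 1)) (.iff (.codedMem (.var 2) (.var 1) (.var 0))
        (hΦ.comp ![2, 1, 0])))
  refine ⟨{t | ∃ m n, Hist m n (t + 1) ∧ CodedMem m n t}, ?_, fun t => ?_⟩
  · have heq : {t | ∃ m n, Hist m n (t + 1) ∧ CodedMem m n t} =
        {t | ∃ w, ∃ m, m ≤ w ∧ ∃ n, n ≤ w ∧ Hist m n (t + 1) ∧ CodedMem m n t} :=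
      Set.ext fun t => exists₂_iff_bounded
    rw [heq]
    exact setOf_exists_mem_sets
      (S := fun t w => ∀ m, m ≤ w → ∀ n, n ≤ w → Hist m n (t + 1) → CodedMem m n t)
      (.bex_le (.var 1) (.bex_le (.var 2) (.and hHist' (.codedMem (.var 1) (.var 0) (.var 2)))))
      (.ball_le (.var 1) (.ball_le (.var 2) (.imp hHist' (.codedMem (.var 1) (.var 0) (.var 2)))))
      fun t => exists₂_iff_bounded.symm.trans ((hΔ t).trans forall₂_iff_bounded)
  · obtain ⟨m, n, h⟩ := hexists (t + 1)
    have hmem : ∀ u, u ≤ t → ((∃ m n, Hist m n (u + 1) ∧ CodedMem m n u) ↔ CodedMem m n u) := by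
      intro u hu
      have h' : Hist m n (u + 1) := fun v hv =>
        h v (hv.trans_le (add_le_add_left hu 1))
      exact ⟨fun hu => (hΔ u).mp hu m n h', fun hu => ⟨m, n, h', hu⟩⟩
    refine (hmem t le_rfl).trans ((h t (lt_self_add_one t)).trans ?_)
    exact hloc _ _ _ fun u hu => (hmem u hu.le).symm

/-! ### Accepted proposals -/

/-- The number `t = ((i, x), k)` proposes to add `A_i` to the subfamily and offers `x` as an
element of the intersection. The number `k` has no meaning; it makes proposals of the same
`i, x` available above every bound. -/
def Proposes (t i : M.Num) : Prop := ∃ x k : M.Num, t = pair (pair i x) k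

/-- The number `y` belongs to the set that `t` proposes. -/
def Fits (A : Set M.Num) (y t : M.Num) : Prop :=
  ∃ i x k : M.Num, t = pair (pair i x) k ∧ y ∈ row A i

/-- The proposal `t` is in `X`, and the element that it offers belongs to the set that it
proposes and to all the sets proposed by the elements of `H` below `t`. -/
def Accepts (A : Set M.Num) (X H : M.Num → Prop) (t : M.Num) : Prop :=
  X t ∧ ∃ i x k : M.Num, t = pair (pair i x) k ∧ x ∈ row A i ∧ ∀ u, u < t → H u → Fits A x u

/-- The set of strings `σ` that settle whether `A_i` is added to the subfamily: for the set `h` of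
the proposals accepted along `σ`, coded by `m` and `n`, either one of them proposes `A_i` or no
`x` belongs to `A_i` and to all the sets proposed by `h`. -/
def Settles (A : Set M.Num) (i σ : M.Num) : Prop :=
  ∀ l m n x : M.Num, HasLength σ l →
    (∀ t, t < l → (CodedMem m n t ↔ Accepts A (EntryOne σ) (CodedMem m n) t)) →
    x ∈ row A i → (∀ t, t < l → CodedMem m n t → Fits A x t) →
    ∃ t, t < l ∧ CodedMem m n t ∧ Proposes t i

theorem Proposes.fits_iff {A : Set M.Num} {t i y : M.Num} (h : Proposes t i) :
    Fits A y t ↔ y ∈ row A i := by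
  obtain ⟨x, k, rfl⟩ := h
  constructor
  · rintro ⟨i', x', k', h, hy⟩
    rwa [(pair_inj.mp (pair_inj.mp h).1).1]
  · exact fun hy => ⟨i, x, k, rfl, hy⟩

theorem Proposes.le {t i : M.Num} (h : Proposes t i) : i ≤ t := by
  obtain ⟨x, k, rfl⟩ := h
  exact (left_le_pair i x).trans (left_le_pair _ _)

theorem accepts_congr {N : L2Structure.{u}} {A : Set N.Num} {X Y H K : N.Num → Prop} {t : N.Num}
    (hX : X t ↔ Y t)
    (h : ∀ u, u < t → (H u ↔ K u)) : Accepts A X H t ↔ Accepts A Y K t := by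
  have : ∀ x, (∀ u, u < t → H u → Fits A x u) ↔ ∀ u, u < t → K u → Fits A x u :=
    fun x => forall₂_congr fun u hu => by rw [h u hu]
  simp only [Accepts, hX, this]

theorem IsSigma00.exists_triple {m : ℕ} {f : (Fin m → M.Num) → M.Num}
    {R : M.Num → M.Num → M.Num → (Fin m → M.Num) → Prop} (hf : IsTerm f)
    (hR : M.IsSigma00 (fun b : Fin (m + 3) → M.Num =>
      R (b 2) (b 1) (b 0) (fun i => b i.succ.succ.succ))) :
    M.IsSigma00 (fun a => ∃ i x k, f a = pair (pair i x) k ∧ R i x k a) := by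
  refine (IsSigma00.bex_le (R := fun i a => ∃ x, x ≤ f a ∧ ∃ k, k ≤ f a ∧
    f a = pair (pair i x) k ∧ R i x k a) hf (.bex_le hf.tail (.bex_le hf.tail.tail
    (.and (.eq hf.tail.tail.tail (.pair (.pair (.var 2) (.var 1)) (.var 0))) hR)))).congr
    fun a => ?_
  constructor
  · rintro ⟨i, x, k, h, hR⟩
    refine ⟨i, ?_, x, ?_, k, ?_, h, hR⟩ <;> rw [h]
    · exact (left_le_pair _ _).trans (left_le_pair _ _)
    · exact (right_le_pair _ _).trans (left_le_pair _ _)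
    · exact right_le_pair _ _
  · rintro ⟨i, -, x, -, k, -, h⟩
    exact ⟨i, x, k, h⟩

theorem IsSigma00.fits {A : Set M.Num} (hA : A ∈ M.Sets) {m : ℕ}
    {f g : (Fin m → M.Num) → M.Num} (hf : IsTerm f) (hg : IsTerm g) :
    M.IsSigma00 (fun a => Fits A (f a) (g a)) :=
  .exists_triple hg (.mem hA (.pair hf.tail.tail.tail (.var 2)))

theorem IsSigma00.proposes {m : ℕ} {f g : (Fin m → M.Num) → M.Num} (hf : IsTerm f)
    (hg : IsTerm g) : M.IsSigma00 (fun a => Proposes (f a) (g a)) :=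
  (IsSigma00.exists_triple (R := fun i _ _ a => i = g a) hf
    (.eq (.var 2) hg.tail.tail.tail)).congr fun a =>
      ⟨fun ⟨x, k, h⟩ => ⟨g a, x, k, h, rfl⟩, fun ⟨_, x, k, h, hi⟩ => ⟨x, k, hi ▸ h⟩⟩

theorem IsSigma00.accepts {A : Set M.Num} (hA : A ∈ M.Sets) {m : ℕ}
    {X H : (Fin m → M.Num) → M.Num → Prop} {f : (Fin m → M.Num) → M.Num} (hf : IsTerm f)
    (hX : M.IsSigma00 (fun a => X a (f a)))
    (hH : M.IsSigma00 (fun b : Fin (m + 1) → M.Num => H (fun i => b i.succ) (b 0))) :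
    M.IsSigma00 (fun a => Accepts A (X a) (H a) (f a)) := by
  refine .and hX (.exists_triple hf (.and (.mem hA (.pair (.var 1) (.var 2)))
    (.ball hf.tail.tail.tail (.imp ?_ (.fits hA (.var 2) (.var 0))))))
  exact hH.comp (Fin.cons 0 (fun i => i.succ.succ.succ.succ) : Fin (m + 1) → Fin (m + 3 + 1))

theorem isUniformlyPi01_settles {A : Set M.Num} (hA : A ∈ M.Sets) :
    M.IsUniformlyPi01 (Settles A) := by
  refine ⟨fun a => ∀ l, l ≤ a 2 → ∀ m, m ≤ a 2 → ∀ n, n ≤ a 2 → ∀ x, x ≤ a 2 →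
    HasLength (a 1) l →
    (∀ t, t < l → (CodedMem m n t ↔ Accepts A (EntryOne (a 1)) (CodedMem m n) t)) →
    x ∈ row A (a 0) → (∀ t, t < l → CodedMem m n t → Fits A x t) →
    ∃ t, t < l ∧ CodedMem m n t ∧ Proposes t (a 0), ?_, fun i σ => ?_⟩
  · refine .ball_le (.var 2) (.ball_le (.var 3) (.ball_le (.var 4) (.ball_le (.var 5)
      (.imp (.hasLength (.var 5) (.var 3)) (.imp (.ball (.var 3) (.iff
        (.codedMem (.var 3) (.var 2) (.var 0)) (.accepts hA (.var 0)
        (.entryOne (.var 6) (.var 0)) (.codedMem (.var 4) (.var 3) (.var 0)))))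
      (.imp (.mem hA (.pair (.var 0) (.var 4))) (.imp (.ball (.var 3) (.imp
        (.codedMem (.var 3) (.var 2) (.var 0)) (.fits hA (.var 1) (.var 0))))
      (.bex (.var 3) (.and (.codedMem (.var 3) (.var 2) (.var 0))
        (.proposes (.var 0) (.var 5)))))))))))
  · constructor
    · intro h w l _ m _ n _ x _
      exact h l m n x
    · intro h l m n x
      exact h (max (max l m) (max n x)) l (by simp) m (by simp) n (by simp) x (by simp)

theorem isDense_settles (A : Set M.Num) (i : M.Num) :
    IsDense (Settles A i) := by
  intro σ hσ
  by_cases hset : Settles A i σ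
  · obtain ⟨l, hl⟩ := hσ.1
    exact ⟨σ, hσ, ⟨l, l, hl, hl, Or.inr rfl, fun _ _ => Iff.rfl⟩, hset⟩
  unfold Settles at hset
  push Not at hset
  obtain ⟨l, m, n, x, hl, hist, hxi, hfits, -⟩ := hset
  -- Extend `σ` by zeros up to the proposal `s` of `i` with the element `x`, and by a one there.
  set s : M.Num := pair (pair i x) l with hs
  have hls : l ≤ s := right_le_pair _ _
  have hX : {t | (t < l ∧ EntryOne σ t) ∨ t = s} ∈ M.Sets :=
    setOf_mem_sets (.or (.and (.lt (.var 0) (.const l)) (.entryOne (.const σ) (.var 0)))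
      (.eq (.var 0) (.const s)))
  obtain ⟨τ, hτ, hlτ, hent⟩ := exists_isString hX (s + 1)
  have hent₁ : ∀ t, t < l → (EntryOne τ t ↔ EntryOne σ t) := by
    intro t ht
    rw [hent t (ht.trans_le (hls.trans (lt_self_add_one s).le))]
    simp [ht, (ht.trans_le hls).ne]
  refine ⟨τ, hτ, ⟨l, s + 1, hl, hlτ, Or.inl (lt_add_one_iff.mpr hls),
    fun t ht => (hent₁ t ht).symm⟩, ?_⟩
  intro l' m' n' _ hl' hist' _ _
  obtain rfl := hl'.unique hlτ
  have hagree : ∀ t, t < l → (CodedMem m n t ↔ CodedMem m' n' t) := by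
    refine recursion_unique (Φ := Accepts A (EntryOne σ))
      (.codedMem (.const m) (.const n) (.var 0)) (.codedMem (.const m') (.const n') (.var 0))
      (fun t h => accepts_congr Iff.rfl h) hist fun t ht => ?_
    rw [hist' t (ht.trans_le (hls.trans (lt_self_add_one s).le))]
    exact accepts_congr (hent₁ t ht) fun _ _ => Iff.rfl
  refine ⟨s, lt_self_add_one s, ?_, x, l, hs⟩
  rw [hist' s (lt_self_add_one s)]
  refine ⟨(hent s (lt_self_add_one s)).mpr (Or.inr rfl), i, x, l, hs, hxi, fun u hu hmem => ?_⟩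
  have hul : u < l := by
    have := ((hist' u (hu.trans (lt_self_add_one s))).mp hmem).1
    rcases (hent u (hu.trans (lt_self_add_one s))).mp this with h | h
    · exact h.1
    · exact absurd h hu.ne
  exact hfits u hul ((hagree u hul).mpr hmem)

/-- The outcome of the forcing argument: a set `H` of proposals each of which offers an element of
the sets proposed so far, such that each `A_i` is proposed or is disjoint from the intersection
of finitely many of the proposed sets. -/
theorem exists_maximal_proposals (hG : M.SatisfiesPi01G) {A : Set M.Num} (hA : A ∈ M.Sets) :
    ∃ H ∈ M.Sets,
      (∀ t ∈ H, ∃ i x k, t = pair (pair i x) k ∧ x ∈ row A i ∧ ∀ u, u < t → u ∈ H → Fits A x u) ∧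
      ∀ i, (∃ t ∈ H, Proposes t i) ∨
        ∃ s, ∀ x ∈ row A i, ∃ t, t < s ∧ t ∈ H ∧ ¬ Fits A x t := by
  obtain ⟨G, hGS, hgen⟩ := hG (Settles A) (isUniformlyPi01_settles hA) (isDense_settles A)
  obtain ⟨H, hH, hrec⟩ := exists_recursive_set (Φ := Accepts A (· ∈ G))
    (.accepts hA (.var 2) (.mem hGS (.var 2)) (.codedMem (.var 1) (.var 2) (.var 0)))
    (fun X Y t h => accepts_congr Iff.rfl h)
  refine ⟨H, hH, fun t ht => ((hrec t).mp ht).2, fun i => ?_⟩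
  obtain ⟨s, σ, ⟨-, hs, hσ⟩, hset⟩ := hgen i
  obtain ⟨m, n, -, -, -, hcode⟩ := exists_code hH s
  have hist : ∀ t, t < s → (CodedMem m n t ↔ Accepts A (EntryOne σ) (CodedMem m n) t) := by
    intro t ht
    rw [hcode t ht, hrec t]
    exact accepts_congr (hσ t ht).symm fun u hu => (hcode u (hu.trans ht)).symm
  by_contra hno
  push Not at hno
  obtain ⟨hno, hmeet⟩ := hno
  obtain ⟨x, hx, hfit⟩ := hmeet s
  obtain ⟨t, ht, hmem, hprop⟩ := hset s m n x hs hist hx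
    fun t ht hmem => hfit t ht ((hcode t ht).mp hmem)
  exact hno t ((hcode t ht).mp hmem) hprop

/-! ### Maximal subfamilies -/

/-- If some `A_i` is empty, then the subfamily with the only member `∅` is maximal. -/
theorem isMaximalFSubfamily_empty {A : Set M.Num} {i : M.Num} (hi : row A i = ∅) :
    IsMaximalFSubfamily A (∅ : Set M.Num) := by
  refine ⟨fun _ => ⟨i, hi.symm⟩, ?_, fun C _ hCA hC hBC k => ?_⟩
  · rintro F - ⟨j, hj, k, hk, hjk⟩ hF hne
    obtain ⟨_, hj'⟩ := hF j hj
    obtain ⟨_, hk'⟩ := hF k hk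
    exact absurd (hj'.trans hk'.symm) (hne j hj k hk hjk)
  · obtain ⟨j, hj⟩ := hCA k
    have hiC : InFamily (row A i) C := by
      obtain ⟨e, he⟩ := hBC 0
      exact ⟨e, hi.trans he⟩
    refine ⟨0, ?_⟩
    by_contra hk
    have hij : row A i ≠ row A j := fun h => hk (hj.trans (h.symm.trans hi))
    have hF : IsFiniteSet ({a | a = i ∨ a = j} : Set M.Num) := by
      refine ⟨setOf_mem_sets (.or (.eq (.var 0) (.const i)) (.eq (.var 0) (.const j))),
        max i j + 1, ?_⟩
      rintro a (rfl | rfl)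
      · exact lt_add_one_iff.mpr (le_max_left _ _)
      · exact lt_add_one_iff.mpr (le_max_right _ _)
    obtain ⟨x, hx⟩ := hC _ hF ⟨i, Or.inl rfl, j, Or.inr rfl, fun h => hij (h ▸ rfl)⟩
      (by
        rintro a (rfl | rfl)
        · exact hiC
        · exact ⟨k, hj.symm⟩)
      (by
        rintro a (rfl | rfl) b (rfl | rfl) hab
        · exact absurd rfl hab
        · exact hij
        · exact hij.symm
        · exact absurd rfl hab)
    have := hx i (Or.inl rfl)
    rw [hi] at this
    exact this

/-- If all `A_i` are nonempty, then in the F intersection property the members need not be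
distinct: among the codes of subsets of `F` with empty intersection take the one with the least
`n`. If it contained indices `i ≠ j` of equal members, then division of `n` by the modulus of `i`
would remove `i` and leave the intersection unchanged. -/
theorem HasFIntersection.exists_mem {A C : Set M.Num} (hA : A ∈ M.Sets)
    (hne : ∀ i, row A i ≠ ∅) (hC : HasFIntersection A C) {F : Set M.Num} (hF : IsFiniteSet F)
    (hFC : ∀ i ∈ F, InFamily (row A i) C) : ∃ x : M.Num, ∀ i ∈ F, x ∈ row A i := by
  by_contra hno
  push Not at hno
  obtain ⟨hFS, c, hc⟩ := hF
  obtain ⟨m, n₀, hm, hn₀, hinv, hcode⟩ := exists_code hFS c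
  obtain ⟨n, hn, hmin⟩ := exists_least_forall
    (R := fun n x => 0 < n ∧ (∀ i, i < c → CodedMem m n i → i ∈ F) ∧
      ∃ i, i < c ∧ CodedMem m n i ∧ x ∉ row A i)
    (.and (.lt (.const 0) (.var 0)) (.and (.ball (.const c) (.imp
      (.codedMem (.const m) (.var 1) (.var 0)) (.mem hFS (.var 0)))) (.bex (.const c) (.and
      (.codedMem (.const m) (.var 1) (.var 0)) (.not (.mem hA (.pair (.var 2) (.var 0))))))))
    ⟨n₀, fun x => ⟨hn₀, fun i hi h => (hcode i hi).mp h, by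
      obtain ⟨i, hi, hx⟩ := hno x
      exact ⟨i, hc i hi, (hcode i (hc i hi)).mpr hi, hx⟩⟩⟩
  obtain ⟨hnpos, hnF, i₀, hi₀, hmem₀, -⟩ := hn 0
  have hempty : ∀ x, ∃ i, i < c ∧ CodedMem m n i ∧ x ∉ row A i := fun x => (hn x).2.2
  have hF' : IsFiniteSet {i : M.Num | i < c ∧ CodedMem m n i} :=
    ⟨setOf_mem_sets (.and (.lt (.var 0) (.const c)) (.codedMem (.const m) (.const n) (.var 0))),
      c, fun i hi => hi.1⟩
  by_cases htwo : ∃ j, j < c ∧ CodedMem m n j ∧ i₀ ≠ j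
  · obtain ⟨j₀, hj₀, hmem₁, hij₀⟩ := htwo
    have hequal : ∃ i j, (i < c ∧ CodedMem m n i) ∧ (j < c ∧ CodedMem m n j) ∧ i ≠ j ∧
        row A i = row A j := by
      by_contra hdist
      push Not at hdist
      obtain ⟨x, hx⟩ := hC _ hF' ⟨i₀, ⟨hi₀, hmem₀⟩, j₀, ⟨hj₀, hmem₁⟩, hij₀⟩
        (fun i hi => hFC i (hnF i hi.1 hi.2)) fun i hi j hj hij => hdist i j hi hj hij
      obtain ⟨i, hi, hi', hxi⟩ := hempty x
      exact hxi (hx i ⟨hi, hi'⟩)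
    obtain ⟨i, j, ⟨hi, hid⟩, ⟨hj, hjd⟩, hij, hrow⟩ := hequal
    obtain ⟨q, rfl⟩ := hid
    have hq : 0 < q := by
      rcases hM.out.semiring.eq_zero_or_pos q with rfl | h
      · simp at hnpos
      · exact h
    have hlt : q < (m * (i + 1) + 1) * q := by
      have : (m * (i + 1) + 1) * q = q + m * (i + 1) * q := by ring
      rw [this]
      exact lt_add_of_pos_right _
        (mul_pos (mul_pos hm (lt_of_le_of_lt zero_le (lt_self_add_one i))) hq)
    refine hmin q hlt fun x => ⟨hq, fun k hk hkq => hnF k hk (hkq.mul_left _), ?_⟩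
    have hkeep : ∀ k, k < c → k ≠ i → CodedMem m ((m * (i + 1) + 1) * q) k → CodedMem m q k :=
      fun k hk hki h => (hinv k hk i hi hki).dvd_of_dvd_mul h
    obtain ⟨k, hk, hkd, hxk⟩ := hempty x
    by_cases hki : k = i
    · subst hki
      exact ⟨j, hj, hkeep j hj hij.symm hjd, hrow ▸ hxk⟩
    · exact ⟨k, hk, hkeep k hk hki hkd, hxk⟩
  · push Not at htwo
    obtain ⟨x, hx⟩ := Set.nonempty_iff_ne_empty.mpr (hne i₀)
    obtain ⟨i, hi, hi', hxi⟩ := hempty x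
    rw [← htwo i hi hi'] at hxi
    exact hxi hx

/-- The sets proposed by the members of a maximal set of proposals form a maximal subfamily. -/
theorem exists_isMaximalFSubfamily_of_nonempty (hG : M.SatisfiesPi01G) {A : Set M.Num}
    (hA : A ∈ M.Sets) (hne : ∀ i, row A i ≠ ∅) : ∃ B ∈ M.Sets, IsMaximalFSubfamily A B := by
  obtain ⟨H, hH, hacc, hmax⟩ := exists_maximal_proposals hG hA
  have hprop : ∀ t ∈ H, ∃ i, Proposes t i := fun t ht => by
    obtain ⟨i, x, k, h, -⟩ := hacc t ht
    exact ⟨i, x, k, h⟩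
  have hinter : ∀ b : M.Num, ∃ x, ∀ t, t < b → t ∈ H → Fits A x t := by
    refine sigma01_induction (.ball (.var 0) (.imp (.mem hH (.var 0))
      (.fits hA (.var 2) (.var 0)))) ?_ ?_
    · exact ⟨0, fun t ht => absurd ht not_lt_zero⟩
    · rintro b ⟨y, hy⟩
      by_cases hb : b ∈ H
      · obtain ⟨i, x, k, hbi, hxi, hx⟩ := hacc b hb
        refine ⟨x, fun t ht htH => ?_⟩
        rcases (lt_add_one_iff.mp ht).lt_or_eq with htb | rfl
        · exact hx t htb htH
        · exact ⟨i, x, k, hbi, hxi⟩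
      · refine ⟨y, fun t ht htH => ?_⟩
        rcases (lt_add_one_iff.mp ht).lt_or_eq with htb | rfl
        · exact hy t htb htH
        · exact absurd htH hb
  -- If `A_i` is proposed under some index `j`, then it cannot be disjoint from the intersection of
  -- proposed sets, so it is also proposed under the index `i`.
  have hclosed : ∀ i j t, t ∈ H → Proposes t j → row A i = row A j →
      ∃ t ∈ H, Proposes t i := by
    intro i j t ht htj hij
    refine (hmax i).resolve_right ?_
    rintro ⟨s, hs⟩
    obtain ⟨x, hx⟩ := hinter (max s (t + 1))
    have hxi : x ∈ row A i :=
      hij ▸ htj.fits_iff.mp (hx t (lt_max_of_lt_right (lt_self_add_one t)) ht)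
    obtain ⟨u, hu, huH, hxu⟩ := hs x hxi
    exact hxu (hx u (lt_max_of_lt_left hu) huH)
  obtain ⟨t₀, ht₀⟩ : ∃ t, t ∈ H := by
    by_contra hno
    push Not at hno
    rcases hmax 0 with ⟨t, ht, -⟩ | ⟨s, hs⟩
    · exact hno t ht
    · obtain ⟨x, hx⟩ := Set.nonempty_iff_ne_empty.mpr (hne 0)
      obtain ⟨t, -, ht, -⟩ := hs x hx
      exact hno t ht
  -- The `j`-th member of `B` is the set proposed by `j` if `j ∈ H`, and by `t₀` otherwise.
  let B : Set M.Num := {p | ∃ y, y ≤ p ∧ ∃ j, j ≤ p ∧ p = pair y j ∧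
    ((j ∈ H ∧ Fits A y j) ∨ (j ∉ H ∧ Fits A y t₀))}
  have hB : B ∈ M.Sets := setOf_mem_sets (.bex_le (.var 0) (.bex_le (.var 1)
    (.and (.eq (.var 2) (.pair (.var 1) (.var 0))) (.or
      (.and (.mem hH (.var 0)) (.fits hA (.var 1) (.var 0)))
      (.and (.not (.mem hH (.var 0))) (.fits hA (.var 1) (.const t₀)))))))
  have hrow : ∀ j y, y ∈ row B j ↔ (j ∈ H ∧ Fits A y j) ∨ (j ∉ H ∧ Fits A y t₀) := by
    intro j y
    constructor
    · rintro ⟨y', -, j', -, hp, h⟩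
      obtain ⟨rfl, rfl⟩ := pair_inj.mp hp
      exact h
    · exact fun h => ⟨y, left_le_pair _ _, j, right_le_pair _ _, rfl, h⟩
  have hrowH : ∀ t i, t ∈ H → Proposes t i → row B t = row A i := by
    intro t i ht hti
    ext y
    rw [hrow, hti.fits_iff]
    simp [ht]
  have hrowB : ∀ j, ∃ t ∈ H, ∃ i, Proposes t i ∧ row B j = row A i := by
    intro j
    by_cases hj : j ∈ H
    · obtain ⟨i, hi⟩ := hprop j hj
      exact ⟨j, hj, i, hi, hrowH j i hj hi⟩
    · obtain ⟨i, hi⟩ := hprop t₀ ht₀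
      refine ⟨t₀, ht₀, i, hi, ?_⟩
      ext y
      rw [hrow, hi.fits_iff]
      simp [hj]
  refine ⟨B, hB, fun j => ?_, ?_, fun C hCS hCA hC hBC j => ?_⟩
  · obtain ⟨t, -, i, -, h⟩ := hrowB j
    exact ⟨i, h⟩
  · rintro F ⟨hFS, c, hc⟩ - hFB -
    have hmem : ∀ i ∈ F, ∃ t ∈ H, Proposes t i := by
      intro i hi
      obtain ⟨j, hj⟩ := hFB i hi
      obtain ⟨t, ht, k, htk, hk⟩ := hrowB j
      exact hclosed i k t ht htk (hj.trans hk)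
    -- One stage `w` of `H` proposes all the members indexed by `F`.
    have hbound : ∀ c : M.Num, ∃ w, ∀ i, i < c → i ∈ F → ∃ t, t < w ∧ t ∈ H ∧ Proposes t i := by
      refine sigma01_induction (.ball (.var 0) (.imp (.mem hFS (.var 0)) (.bex (.var 2)
        (.and (.mem hH (.var 0)) (.proposes (.var 0) (.var 1)))))) ?_ ?_
      · exact ⟨0, fun i hi => absurd hi not_lt_zero⟩
      · rintro c ⟨w, hw⟩
        by_cases hcF : c ∈ F
        · obtain ⟨t, ht, htc⟩ := hmem c hcF
          refine ⟨max w (t + 1), fun i hi hiF => ?_⟩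
          rcases (lt_add_one_iff.mp hi).lt_or_eq with hi | rfl
          · obtain ⟨u, hu, h⟩ := hw i hi hiF
            exact ⟨u, lt_max_of_lt_left hu, h⟩
          · exact ⟨t, lt_max_of_lt_right (lt_self_add_one t), ht, htc⟩
        · refine ⟨w, fun i hi hiF => ?_⟩
          rcases (lt_add_one_iff.mp hi).lt_or_eq with hi | rfl
          · exact hw i hi hiF
          · exact absurd hiF hcF
    obtain ⟨w, hw⟩ := hbound c
    obtain ⟨x, hx⟩ := hinter w
    refine ⟨x, fun i hi => ?_⟩
    obtain ⟨t, ht, htH, hti⟩ := hw i (hc i hi) hi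
    exact hti.fits_iff.mp (hx t ht htH)
  · obtain ⟨i, hi⟩ := hCA j
    suffices h : ∃ t ∈ H, Proposes t i by
      obtain ⟨t, ht, hti⟩ := h
      exact ⟨t, hi.trans (hrowH t i ht hti).symm⟩
    refine (hmax i).resolve_right ?_
    rintro ⟨s, hs⟩
    -- Together with `A_i`, the sets proposed below `s` would be finitely many members of `C`
    -- without a common element.
    have hF : IsFiniteSet {k : M.Num | k = i ∨ ∃ t, t < s ∧ t ∈ H ∧ Proposes t k} := by
      refine ⟨setOf_mem_sets (.or (.eq (.var 0) (.const i)) (.bex (.const s)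
        (.and (.mem hH (.var 0)) (.proposes (.var 0) (.var 1))))), max (i + 1) s, ?_⟩
      rintro k (rfl | ⟨t, ht, -, htk⟩)
      · exact lt_max_of_lt_left (lt_self_add_one k)
      · exact lt_max_of_lt_right (htk.le.trans_lt ht)
    obtain ⟨x, hx⟩ := hC.exists_mem hA hne hF (by
      rintro k (rfl | ⟨t, -, htH, htk⟩)
      · exact ⟨j, hi.symm⟩
      · rw [← hrowH t k htH htk]
        exact hBC t)
    obtain ⟨t, ht, htH, hxt⟩ := hs x (hx i (Or.inl rfl))
    obtain ⟨k, htk⟩ := hprop t htH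
    exact hxt (htk.fits_iff.mpr (hx k (Or.inr ⟨t, ht, htH, htk⟩)))

end L2Structure

theorem propositionP (M : L2Structure.{u}) (hRCA : M.IsRCA0) (hG : M.SatisfiesPi01G) :
    M.SatisfiesFIP := by
  have : Fact M.IsRCA0 := ⟨hRCA⟩
  intro A hA _
  by_cases hne : ∀ i, L2Structure.row A i ≠ ∅
  · exact L2Structure.exists_isMaximalFSubfamily_of_nonempty hG hA hne
  · push Not at hne
    obtain ⟨i, hi⟩ := hne
    refine ⟨∅, ?_, L2Structure.isMaximalFSubfamily_empty hi⟩
    have : {x : M.Num | x ≠ x} ∈ M.Sets :=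
      L2Structure.setOf_mem_sets (.not (.eq (.var 0) (.var 0)))
    simpa using this
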